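/- Let $\mathscr{W}$ be the space of continuous functions $w:[0,1]\to\mathbb{R}$ with $w(0)=0$, with the topology of uniform convergence and its Borel $\sigma$-field, let $\gamma$ be the Wiener measure on $\mathscr{W}$, and write $E[\,\cdot\,]$ for the integral with respect to $\gamma$. Let $\mathscr{H}\subset\mathscr{W}$ be the Cameron–Martin space, that is, the set of absolutely continuous $h\in\mathscr{W}$ with $\int_0^1\dot h(t)^2\,dt<\infty$. For $h\in\mathscr{H}$ let $[h](w)=\int_0^1\dot h(t)\,dw(t)$ be the Wiener integral, defined for each $w\in\mathscr{W}$ as the limit, as $n\to\infty$, of the integrals along $w$ of the step functions that are equal on each interval $[k2^{-n},(k+1)2^{-n})$ to the mean value of $\dot h$ there, and as $0$ on the $\gamma$-null set of those $w$ for which this limit does not exist. Let $\mathbf{P}$ be the set of all polynomial functionals $F(w)=p([h_1](w),\dots,[h_n](w))$, where $n\in\mathbb{N}$, $h_1,\dots,h_n\in\mathscr{H}$ and $p$ is a real polynomial in $n$ variables. For $\theta\in\mathscr{H}$ and a functional $F$ on $\mathscr{W}$ put $$D_\theta F(w)=\lim_{\varepsilon\to0}\frac{F(w+\varepsilon\theta)-F(w)}{\varepsilon},\qquad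 D_\theta^*F(w)=-D_\theta F(w)+[\theta](w)\,F(w),$$ $$e^{D_\theta}F(w)=\sum_{n=0}^\infty\frac1{n!}D_\theta^nF(w),\qquad e^{D_\theta^*}1(w)=\sum_{n=0}^\infty\frac1{n!}(D_\theta^*)^n1(w).$$ Then for every $\theta\in\mathscr{H}$ and every $F\in\mathbf{P}$ all the derivatives involved in $e^{D_\theta}F$ and $e^{D_\theta^*}1$ exist and both series converge at every $w\in\mathscr{W}$, the four integrands below are $\gamma$-integrable, and $$\int_{\mathscr{W}}F(w+\theta)\,\gamma(dw)=E\big[e^{D_\theta}F\big]=E\big[F\cdot e^{D_\theta^*}1\big]=\int_{\mathscr{W}}F(w)\exp\Big\{\int_0^1\dot\theta(t)\,dw(t)-\frac12\int_0^1\dot\theta(t)^2\,dt\Big\}\,\gamma(dw).$$ -/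

import Mathlib

open MeasureTheory ProbabilityTheory Filter Topology
open scoped Nat

/-- The continuous real functions on `[0,1]` that vanish at `0`, as a subspace of `C([0,1], ℝ)`. -/
def wienerSubmodule : Submodule ℝ C(unitInterval, ℝ) where
  carrier := {w | w 0 = 0}
  add_mem' := by
    intro a b ha hb
    simp only [Set.mem_ofPred_eq] at ha hb ⊢
    simp [ha, hb]
  zero_mem' := by simp
  smul_mem' := by
    intro c a ha
    simp only [Set.mem_ofPred_eq] at ha ⊢
    simp [ha]

/-- The path space `𝓦`, with the topology of uniform convergence (the sup norm). -/
abbrev WienerSpace : Type := ↥wienerSubmodule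

/-- The `σ`-field on `𝓦` generated by the topology of uniform convergence. -/
instance WienerSpace.measurableSpace : MeasurableSpace WienerSpace := borel WienerSpace

instance WienerSpace.borelSpace : BorelSpace WienerSpace := ⟨rfl⟩

/-- `γ` is the Wiener measure on `𝓦`: the probability measure under which the coordinate process
`W(t, w) = w(t)` has independent increments and `W(t) - W(s)` is centered Gaussian with variance
`t - s` for `s ≤ t`. -/
structure IsWienerMeasure (γ : Measure WienerSpace) : Prop where
  isProbabilityMeasure : IsProbabilityMeasure γ
  hasIndepIncrements :
    HasIndepIncrements (fun (t : unitInterval) (w : WienerSpace) => w.1 t) γ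
  hasLaw_increment : ∀ s t : unitInterval, s ≤ t →
    HasLaw (fun w : WienerSpace => w.1 t - w.1 s) (gaussianReal 0 (Real.toNNReal (t - s))) γ

/-- A path as a function of a real time (constant to the left of `0` and to the right of `1`). -/
noncomputable def WienerSpace.path (w : WienerSpace) (t : ℝ) : ℝ :=
  w.1 (Set.projIcc (0 : ℝ) 1 zero_le_one t)

/-- The time derivative `ḣ` of a path (only its values in `(0,1)` matter). -/
noncomputable def WienerSpace.velocity (h : WienerSpace) : ℝ → ℝ := deriv h.path

/-- The Cameron-Martin space `𝓗`: the absolutely continuous paths with square-integrable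
derivative. -/
def cameronMartinSpace : Set WienerSpace :=
  {h | AbsolutelyContinuousOnInterval h.path 0 1 ∧
    MemLp h.velocity 2 (volume.restrict (Set.Icc (0 : ℝ) 1))}

/-- The stochastic integral along `w` of the step function which on every dyadic interval
`[k/2ⁿ, (k+1)/2ⁿ)` is equal to the mean value of `g` over this interval. -/
noncomputable def dyadicIntegral (g : ℝ → ℝ) (n : ℕ) (w : WienerSpace) : ℝ :=
  ∑ k ∈ Finset.range (2 ^ n),
    (2 ^ n * ∫ t in ((k : ℝ) / 2 ^ n)..(((k : ℝ) + 1) / 2 ^ n), g t) *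
      (w.path (((k : ℝ) + 1) / 2 ^ n) - w.path ((k : ℝ) / 2 ^ n))

open Classical in
/-- The Wiener integral `∫₀¹ g(t) dw(t)` of a deterministic `g ∈ L²([0,1])`, defined for every
single path `w`: the limit of the integrals of the dyadic step functions approximating `g` in `L²`,
and `0` on the null set of those `w` where this limit does not exist. (For the Wiener measure the
approximations form an `L²`-bounded martingale in `n`, so that they converge almost surely and in
`L²`. For a path in the Cameron-Martin space they converge to `∫₀¹ g(t) ẇ(t) dt`, so that the set
of convergence is invariant under translations by Cameron-Martin paths.) -/
noncomputable def wienerIntegral (g : ℝ → ℝ) (w : WienerSpace) : ℝ :=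
  if H : ∃ L : ℝ, Tendsto (fun n => dyadicIntegral g n w) atTop (𝓝 L) then H.choose else 0

/-- `[h](w) = ∫₀¹ ḣ(t) dw(t)`. -/
noncomputable def bracket (h w : WienerSpace) : ℝ := wienerIntegral h.velocity w

/-- The polynomial functionals: `F(w) = p([h₁](w), …, [hₙ](w))` for a real polynomial `p` in `n`
variables and Cameron-Martin paths `h₁, …, hₙ`. -/
def polynomialFunctionals : Set (WienerSpace → ℝ) :=
  {F | ∃ (n : ℕ) (h : Fin n → WienerSpace) (p : MvPolynomial (Fin n) ℝ),
    (∀ i, h i ∈ cameronMartinSpace) ∧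
      ∀ w, F w = MvPolynomial.eval (fun i => bracket (h i) w) p}

/-- `D_θ F(w) = lim_{ε → 0} (F(w + ε θ) - F(w)) / ε`. -/
noncomputable def dirDeriv (θ : WienerSpace) (F : WienerSpace → ℝ) : WienerSpace → ℝ :=
  fun w => lineDeriv ℝ F w θ

/-- `D_θ^* F(w) = - D_θ F(w) + (∫₀¹ θ̇(t) dw(t)) F(w)`. -/
noncomputable def dirDerivAdj (θ : WienerSpace) (F : WienerSpace → ℝ) : WienerSpace → ℝ :=
  fun w => - dirDeriv θ F w + bracket θ w * F w

/-- The exponential series `e^A F(w) = ∑ₙ Aⁿ F(w) / n!` of an operator `A` on functionals. -/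
noncomputable def expSeries (A : (WienerSpace → ℝ) → (WienerSpace → ℝ))
    (F : WienerSpace → ℝ) : WienerSpace → ℝ :=
  fun w => ∑' n : ℕ, (1 / (n ! : ℝ)) * (A^[n] F) w

/-- The exponential series `e^A F` is meaningful for an operator `A` that involves the derivative
in the direction `θ`: all the iterates `Aⁿ F` have a derivative in the direction `θ` at every path,
and the series converges at every path. -/
def ExpSeriesWellDefined (θ : WienerSpace) (A : (WienerSpace → ℝ) → (WienerSpace → ℝ))
    (F : WienerSpace → ℝ) : Prop :=
  (∀ (n : ℕ) (w : WienerSpace), LineDifferentiableAt ℝ (A^[n] F) w θ) ∧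
    ∀ w : WienerSpace, Summable fun n : ℕ => (1 / (n ! : ℝ)) * (A^[n] F) w

/-- `exp {∫₀¹ θ̇(t) dw(t) - (1/2) ∫₀¹ θ̇(t)² dt}`. -/
noncomputable def cameronMartinDensity (θ w : WienerSpace) : ℝ :=
  Real.exp (wienerIntegral θ.velocity w - 1 / 2 * ∫ t in (0 : ℝ)..1, θ.velocity t ^ 2)

/-! Everything reduces to lines `w + ε • θ` and to finitely many Wiener integrals.

On a line, the dyadic integrals of `ḣ` along `θ` converge to `⟨ḣ, θ̇⟩` in `L²`. Hence convergence at
`w` and at `w + ε • θ` are equivalent, and `[h]` is affine in `ε` at every `w`, with slope `⟨ḣ, θ̇⟩`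
on the set of convergence and `0` off it (`wienerIntegral_add_smul`). So `F` is polynomial on each
line, and `e^{D_θ} F (w) = F (w + θ)` is its exact Taylor expansion
(`expSeries_dirDeriv_of_polynomial`). The iterates of `D_θ^*` on `1` are Hermite polynomials in
`[θ]` whose variance parameter is the slope of `[θ]`; their generating function sums the series to
the Cameron-Martin density, almost everywhere (`expSeries_dirDerivAdj_one`).

What remains is the translation formula. As `F` depends on finitely many Wiener integrals, it
suffices that their joint law under the density is their law under `γ` shifted by the numbers `⟨ḣᵢ,
θ̇⟩` (`IsWienerMeasure.map_tilted_eq_map_add`). Linear functionals reduce this to one integral,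
where completing a square in the moment generating function gives the shift. The Gaussian law of a
Wiener integral is the limit of the laws of its dyadic approximations, an `L²`-bounded martingale.
-/

/-! ### Dyadic averages in `L²([0,1])` -/

/-- The `L²([0,1])` inner product. -/
noncomputable def unitInner (f g : ℝ → ℝ) : ℝ := ∫ t in (0 : ℝ)..1, f t * g t

/-- The inner product of the dyadic averages of `f` and `g`. -/
noncomputable def dyadicForm (n : ℕ) (f g : ℝ → ℝ) : ℝ :=
  ∑ k ∈ Finset.range (2 ^ n),
    (2 ^ n * ∫ t in ((k : ℝ) / 2 ^ n)..(((k : ℝ) + 1) / 2 ^ n), f t) *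
      ∫ t in ((k : ℝ) / 2 ^ n)..(((k : ℝ) + 1) / 2 ^ n), g t

/-- Square integrability on the unit interval. -/
abbrev UnitL2 (f : ℝ → ℝ) : Prop := MemLp f 2 (volume.restrict (Set.Icc (0 : ℝ) 1))

lemma UnitL2.intervalIntegrable_mul {f g : ℝ → ℝ} (hf : UnitL2 f) (hg : UnitL2 g) {a b : ℝ}
    (ha : 0 ≤ a) (hab : a ≤ b) (hb : b ≤ 1) :
    IntervalIntegrable (fun t => f t * g t) volume a b := by
  rw [intervalIntegrable_iff_integrableOn_Icc_of_le hab]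
  have h : IntegrableOn (fun t => f t * g t) (Set.Icc 0 1) := MemLp.integrable_mul hf hg
  exact h.mono_set (Set.Icc_subset_Icc ha hb)

lemma UnitL2.intervalIntegrable {f : ℝ → ℝ} (hf : UnitL2 f) {a b : ℝ}
    (ha : 0 ≤ a) (hab : a ≤ b) (hb : b ≤ 1) : IntervalIntegrable f volume a b := by
  rw [intervalIntegrable_iff_integrableOn_Icc_of_le hab]
  have h : IntegrableOn f (Set.Icc 0 1) := hf.integrable (by norm_num)
  exact h.mono_set (Set.Icc_subset_Icc ha hb)

lemma dyadic_bounds {n k : ℕ} (hk : k ∈ Finset.range (2 ^ n)) :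
    0 ≤ (k : ℝ) / 2 ^ n ∧ (k : ℝ) / 2 ^ n ≤ ((k : ℝ) + 1) / 2 ^ n ∧
      ((k : ℝ) + 1) / 2 ^ n ≤ 1 := by
  have hk' : (k : ℝ) + 1 ≤ 2 ^ n := by exact_mod_cast Finset.mem_range.1 hk
  refine ⟨by positivity, by gcongr; linarith, ?_⟩
  rw [div_le_one (by positivity)]
  exact hk'

lemma sum_integral_dyadic (n : ℕ) {f : ℝ → ℝ}
    (hf : ∀ k ∈ Finset.range (2 ^ n), IntervalIntegrable f volume ((k : ℝ) / 2 ^ n)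
      (((k : ℝ) + 1) / 2 ^ n)) :
    ∑ k ∈ Finset.range (2 ^ n), ∫ t in ((k : ℝ) / 2 ^ n)..(((k : ℝ) + 1) / 2 ^ n), f t
      = ∫ t in (0 : ℝ)..1, f t := by
  have h := intervalIntegral.sum_integral_adjacent_intervals (f := f) (μ := volume)
    (a := fun k : ℕ => (k : ℝ) / 2 ^ n) (n := 2 ^ n)
    (fun k hk => by simpa using hf k (Finset.mem_range.2 hk))
  simpa using h

lemma UnitL2.integral_sub_const_sq {f : ℝ → ℝ} (hf : UnitL2 f) {a b : ℝ}
    (ha : 0 ≤ a) (hab : a ≤ b) (hb : b ≤ 1) (c : ℝ) :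
    ∫ t in a..b, (f t - c) ^ 2
      = (∫ t in a..b, f t * f t) - 2 * c * (∫ t in a..b, f t) + c ^ 2 * (b - a) := by
  have h1 := hf.intervalIntegrable_mul hf ha hab hb
  have h2 := (hf.intervalIntegrable ha hab hb).const_mul (2 * c)
  have : ∀ t, (f t - c) ^ 2 = f t * f t - 2 * c * f t + c ^ 2 := fun t => by ring
  simp_rw [this]
  rw [intervalIntegral.integral_add (h1.sub h2) (by simp), intervalIntegral.integral_sub h1 h2]
  simp
  ring

/-- The mean value minimizes the mean square deviation. -/
lemma UnitL2.integral_sq_sub_le {f : ℝ → ℝ} (hf : UnitL2 f) {a b N : ℝ}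
    (ha : 0 ≤ a) (hab : a ≤ b) (hb : b ≤ 1) (hN : 0 < N) (hL : b - a = 1 / N) (c : ℝ) :
    (∫ t in a..b, f t * f t) - (N * ∫ t in a..b, f t) * (∫ t in a..b, f t)
      ≤ ∫ t in a..b, (f t - c) ^ 2 := by
  rw [hf.integral_sub_const_sq ha hab hb, hL]
  set I := ∫ t in a..b, f t
  have : 0 ≤ N * (I - c / N) ^ 2 := by positivity
  have h2 : N * (I - c / N) ^ 2 = N * I * I - 2 * c * I + c ^ 2 * (1 / N) := by
    field_simp
    ring
  linarith

lemma UnitL2.mul_integral_sq_le {f : ℝ → ℝ} (hf : UnitL2 f) {a b N : ℝ}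
    (ha : 0 ≤ a) (hab : a ≤ b) (hb : b ≤ 1) (hN : 0 < N) (hL : b - a = 1 / N) :
    (N * ∫ t in a..b, f t) * (∫ t in a..b, f t) ≤ ∫ t in a..b, f t * f t := by
  have h := hf.integral_sub_const_sq ha hab hb (N * ∫ t in a..b, f t)
  have h0 : 0 ≤ ∫ t in a..b, (f t - N * ∫ t in a..b, f t) ^ 2 :=
    intervalIntegral.integral_nonneg hab fun _ _ => sq_nonneg _
  rw [h, hL] at h0
  set I := ∫ t in a..b, f t
  have h2 : (N * I) ^ 2 * (1 / N) = N * I * I := by field_simp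
  linarith

lemma dyadic_length (n k : ℕ) : ((k : ℝ) + 1) / 2 ^ n - (k : ℝ) / 2 ^ n = 1 / 2 ^ n := by
  ring

lemma UnitL2.dyadicForm_le {f : ℝ → ℝ} (hf : UnitL2 f) (n : ℕ) :
    dyadicForm n f f ≤ unitInner f f := by
  rw [unitInner, ← sum_integral_dyadic n fun k hk => hf.intervalIntegrable_mul hf
    (dyadic_bounds hk).1 (dyadic_bounds hk).2.1 (dyadic_bounds hk).2.2]
  refine Finset.sum_le_sum fun k hk => ?_
  obtain ⟨h0, h1, h2⟩ := dyadic_bounds hk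
  exact hf.mul_integral_sq_le h0 h1 h2 (by positivity) (dyadic_length n k)

lemma dyadicForm_self_nonneg (n : ℕ) (f : ℝ → ℝ) : 0 ≤ dyadicForm n f f := by
  refine Finset.sum_nonneg fun k _ => ?_
  rw [mul_assoc]
  exact mul_nonneg (by positivity) (mul_self_nonneg _)

/-- The deficit is the sum over the cells of the mean square deviation of `f` from its mean. This
can only grow if the mean is replaced by the left endpoint value of a continuous `g` that is
`L²`-close to `f`; uniform continuity of `g` then makes it small. With `(x + y)² ≤ 2x² + 2y²` and
both errors at most `ε / 8`, the total is at most `ε / 2`. -/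
lemma UnitL2.tendsto_dyadicForm_self {f : ℝ → ℝ} (hf : UnitL2 f) :
    Tendsto (fun n => dyadicForm n f f) atTop (𝓝 (unitInner f f)) := by
  rw [Metric.tendsto_atTop]
  intro ε hε
  obtain ⟨g, -, hfg, hgc, hg⟩ := hf.exists_hasCompactSupport_eLpNorm_sub_le (by norm_num)
    (ε := ENNReal.ofReal (√(ε / 8))) (by simpa using by positivity)
  have hfg2 : ∫ t in (0 : ℝ)..1, (f t - g t) * (f t - g t) ≤ ε / 8 := by
    rw [intervalIntegral.integral_of_le zero_le_one, ← integral_Icc_eq_integral_Ioc]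
    have h := (hf.sub hg).eLpNorm_eq_integral_rpow_norm (by norm_num) (by norm_num)
    rw [h, ENNReal.ofReal_le_ofReal_iff (by positivity)] at hfg
    simp only [Pi.sub_apply, Real.norm_eq_abs, ENNReal.toReal_ofNat, Real.rpow_ofNat, sq_abs]
      at hfg
    rw [← one_div, ← Real.sqrt_eq_rpow] at hfg
    rw [Real.sqrt_le_sqrt_iff (by positivity)] at hfg
    simpa [sq] using hfg
  have huc : UniformContinuousOn g (Set.Icc 0 1) :=
    isCompact_Icc.uniformContinuousOn_of_continuous hgc.continuousOn
  rw [Metric.uniformContinuousOn_iff_le] at huc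
  obtain ⟨δ, hδ, hgδ⟩ := huc (√(ε / 8)) (by positivity)
  obtain ⟨n₀, hn₀⟩ := exists_pow_lt_of_lt_one hδ (by norm_num : (1 / 2 : ℝ) < 1)
  refine ⟨n₀, fun n hn => ?_⟩
  have hN : (1 : ℝ) / 2 ^ n ≤ δ := by
    have : (1 / 2 : ℝ) ^ n ≤ (1 / 2) ^ n₀ := pow_le_pow_of_le_one (by norm_num) (by norm_num) hn
    rw [one_div_pow] at this
    linarith
  rw [Real.dist_eq, abs_sub_comm, abs_of_nonneg (sub_nonneg.2 (hf.dyadicForm_le n))]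
  have hff : ∀ k ∈ Finset.range (2 ^ n), IntervalIntegrable (fun t => f t * f t) volume
      ((k : ℝ) / 2 ^ n) (((k : ℝ) + 1) / 2 ^ n) := fun k hk =>
    hf.intervalIntegrable_mul hf (dyadic_bounds hk).1 (dyadic_bounds hk).2.1 (dyadic_bounds hk).2.2
  have hd : UnitL2 fun t => f t - g t := hf.sub hg
  have hdd : ∀ k ∈ Finset.range (2 ^ n),
      IntervalIntegrable (fun t => (f t - g t) * (f t - g t)) volume
      ((k : ℝ) / 2 ^ n) (((k : ℝ) + 1) / 2 ^ n) := fun k hk =>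
    hd.intervalIntegrable_mul hd (dyadic_bounds hk).1 (dyadic_bounds hk).2.1 (dyadic_bounds hk).2.2
  have key : unitInner f f - dyadicForm n f f
      ≤ ∑ k ∈ Finset.range (2 ^ n), (2 * (∫ t in ((k : ℝ) / 2 ^ n)..(((k : ℝ) + 1) / 2 ^ n),
          (f t - g t) * (f t - g t)) + 2 * (ε / 8) * (1 / 2 ^ n)) := by
    rw [unitInner, ← sum_integral_dyadic n hff, dyadicForm, ← Finset.sum_sub_distrib]
    refine Finset.sum_le_sum fun k hk => ?_
    obtain ⟨h0, h1, h2⟩ := dyadic_bounds hk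
    refine (hf.integral_sq_sub_le h0 h1 h2 (by positivity) (dyadic_length n k)
      (g (k / 2 ^ n))).trans ?_
    have hc : ∫ t in ((k : ℝ) / 2 ^ n)..(((k : ℝ) + 1) / 2 ^ n), (2 * (ε / 8) : ℝ)
        = 2 * (ε / 8) * (1 / 2 ^ n) := by
      rw [intervalIntegral.integral_const, dyadic_length, smul_eq_mul, mul_comm]
    rw [← hc, ← intervalIntegral.integral_const_mul, ← intervalIntegral.integral_add
      ((hdd k hk).const_mul 2) (by simp)]
    have hfc : UnitL2 fun t => f t - g (k / 2 ^ n) := hf.sub (memLp_const _)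
    refine intervalIntegral.integral_mono_on h1 ?_ (((hdd k hk).const_mul 2).add (by simp))
      fun t ht => ?_
    · simpa only [sq] using hfc.intervalIntegrable_mul hfc h0 h1 h2
    · have hx := hgδ t ⟨h0.trans ht.1, ht.2.trans h2⟩ (k / 2 ^ n) ⟨h0, h1.trans h2⟩ (by
        rw [Real.dist_eq, abs_of_nonneg (by linarith [ht.1])]
        linarith [ht.2, dyadic_length n k])
      rw [Real.dist_eq] at hx
      have hx2 : (g t - g (k / 2 ^ n)) ^ 2 ≤ ε / 8 := by
        rw [← Real.sq_sqrt (by positivity : 0 ≤ ε / 8), ← sq_abs]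
        gcongr
      nlinarith [sq_nonneg ((f t - g t) - (g t - g (k / 2 ^ n)))]
  rw [Finset.sum_add_distrib, ← Finset.mul_sum, sum_integral_dyadic n hdd] at key
  simp only [Finset.sum_const, Finset.card_range, nsmul_eq_mul, Nat.cast_pow, Nat.cast_ofNat]
    at key
  have : (2 : ℝ) ^ n * (2 * (ε / 8) * (1 / 2 ^ n)) = 2 * (ε / 8) := by field_simp
  linarith

lemma UnitL2.tendsto_dyadicForm {f g : ℝ → ℝ} (hf : UnitL2 f) (hg : UnitL2 g) :
    Tendsto (fun n => dyadicForm n f g) atTop (𝓝 (unitInner f g)) := by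
  have h1 := UnitL2.tendsto_dyadicForm_self (hf.add hg)
  have h2 := UnitL2.tendsto_dyadicForm_self (hf.sub hg)
  -- Polarization: a quarter of the difference of the forms of `f + g` and `f - g`.
  have h := (h1.sub h2).div_const 4
  have i1 : ∀ {a b : ℝ}, 0 ≤ a → a ≤ b → b ≤ 1 →
    ∫ t in a..b, (f + g) t = (∫ t in a..b, f t) + ∫ t in a..b, g t := fun ha hab hb =>
      intervalIntegral.integral_add (hf.intervalIntegrable ha hab hb)
        (hg.intervalIntegrable ha hab hb)
  have i2 : ∀ {a b : ℝ}, 0 ≤ a → a ≤ b → b ≤ 1 →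
    ∫ t in a..b, (f - g) t = (∫ t in a..b, f t) - ∫ t in a..b, g t := fun ha hab hb =>
      intervalIntegral.integral_sub (hf.intervalIntegrable ha hab hb)
        (hg.intervalIntegrable ha hab hb)
  convert! h using 1
  · ext n
    simp only [dyadicForm]
    rw [← Finset.sum_sub_distrib, Finset.sum_div]
    refine Finset.sum_congr rfl fun k hk => ?_
    obtain ⟨h0, h1, h2⟩ := dyadic_bounds hk
    rw [i1 h0 h1 h2, i2 h0 h1 h2]
    ring
  · congr 1
    have j1 := UnitL2.intervalIntegrable_mul (hf.add hg) (hf.add hg) le_rfl zero_le_one le_rfl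
    have j2 := UnitL2.intervalIntegrable_mul (hf.sub hg) (hf.sub hg) le_rfl zero_le_one le_rfl
    rw [unitInner, unitInner, unitInner, ← intervalIntegral.integral_sub j1 j2,
      ← intervalIntegral.integral_div]
    refine intervalIntegral.integral_congr fun t _ => ?_
    simp only [Pi.add_apply, Pi.sub_apply]
    ring

/-! ### Dyadic integrals along Cameron-Martin paths -/

lemma WienerSpace.path_sub_eq_integral_velocity {θ : WienerSpace} (hθ : θ ∈ cameronMartinSpace)
    {a b : ℝ} (ha : 0 ≤ a) (hab : a ≤ b) (hb : b ≤ 1) :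
    θ.path b - θ.path a = ∫ t in a..b, θ.velocity t := by
  refine (AbsolutelyContinuousOnInterval.integral_deriv_eq_sub (hθ.1.mono ?_)).symm
  rw [Set.uIcc_of_le hab, Set.uIcc_of_le zero_le_one]
  exact Set.Icc_subset_Icc ha hb

lemma dyadicIntegral_cameronMartin {θ : WienerSpace} (hθ : θ ∈ cameronMartinSpace)
    (g : ℝ → ℝ) (n : ℕ) : dyadicIntegral g n θ = dyadicForm n g θ.velocity := by
  refine Finset.sum_congr rfl fun k hk => ?_
  obtain ⟨h0, h1, h2⟩ := dyadic_bounds hk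
  rw [WienerSpace.path_sub_eq_integral_velocity hθ h0 h1 h2]

lemma tendsto_dyadicIntegral_cameronMartin {θ : WienerSpace} (hθ : θ ∈ cameronMartinSpace)
    {g : ℝ → ℝ} (hg : UnitL2 g) :
    Tendsto (fun n => dyadicIntegral g n θ) atTop (𝓝 (unitInner g θ.velocity)) := by
  simp_rw [dyadicIntegral_cameronMartin hθ]
  exact hg.tendsto_dyadicForm hθ.2

lemma dyadicIntegral_add_smul (g : ℝ → ℝ) (n : ℕ) (w θ : WienerSpace) (ε : ℝ) :
    dyadicIntegral g n (w + ε • θ) = dyadicIntegral g n w + ε * dyadicIntegral g n θ := by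
  simp only [dyadicIntegral, WienerSpace.path]
  rw [Finset.mul_sum, ← Finset.sum_add_distrib]
  refine Finset.sum_congr rfl fun k _ => ?_
  simp only [Submodule.coe_add, Submodule.coe_smul, ContinuousMap.add_apply,
    ContinuousMap.smul_apply, smul_eq_mul]
  ring

/-- The dyadic approximations of the Wiener integral of `g` converge along the path `w`. -/
def DyadicConverges (g : ℝ → ℝ) (w : WienerSpace) : Prop :=
  ∃ L : ℝ, Tendsto (fun n => dyadicIntegral g n w) atTop (𝓝 L)

lemma DyadicConverges.tendsto {g : ℝ → ℝ} {w : WienerSpace} (h : DyadicConverges g w) :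
    Tendsto (fun n => dyadicIntegral g n w) atTop (𝓝 (wienerIntegral g w)) := by
  have hw : wienerIntegral g w = Classical.choose h := dif_pos h
  rw [hw]
  exact Classical.choose_spec h

lemma wienerIntegral_of_not_dyadicConverges {g : ℝ → ℝ} {w : WienerSpace}
    (h : ¬ DyadicConverges g w) : wienerIntegral g w = 0 := dif_neg h

lemma wienerIntegral_eq_of_tendsto {g : ℝ → ℝ} {w : WienerSpace} {L : ℝ}
    (h : Tendsto (fun n => dyadicIntegral g n w) atTop (𝓝 L)) : wienerIntegral g w = L :=
  tendsto_nhds_unique (DyadicConverges.tendsto ⟨L, h⟩) h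

open Classical in
/-- The increment of `wienerIntegral g` along `θ`, at a path `w`. It vanishes where the
approximations of the integral do not converge. -/
noncomputable def pathShift (g : ℝ → ℝ) (θ w : WienerSpace) : ℝ :=
  if DyadicConverges g w then unitInner g θ.velocity else 0

/-- Valid at every `w`, as the pathwise derivatives require. Where the approximations diverge at `w`
they diverge on the whole line, so the default value `0` is taken at both points and the slope is
`0`. -/
lemma wienerIntegral_add_smul {θ : WienerSpace} (hθ : θ ∈ cameronMartinSpace)
    {g : ℝ → ℝ} (hg : UnitL2 g) (w : WienerSpace) (ε : ℝ) :
    wienerIntegral g (w + ε • θ) = wienerIntegral g w + ε * pathShift g θ w := by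
  have ht := tendsto_dyadicIntegral_cameronMartin hθ hg
  by_cases h : DyadicConverges g w
  · rw [pathShift, if_pos h]
    refine wienerIntegral_eq_of_tendsto ?_
    simp_rw [dyadicIntegral_add_smul]
    exact h.tendsto.add (ht.const_mul ε)
  · rw [pathShift, if_neg h, wienerIntegral_of_not_dyadicConverges h,
      wienerIntegral_of_not_dyadicConverges]
    · simp
    · rintro ⟨L, hL⟩
      refine h ⟨L - ε * unitInner g θ.velocity, ?_⟩
      simp_rw [dyadicIntegral_add_smul] at hL
      simpa using hL.sub (ht.const_mul ε)

lemma dyadicConverges_add_smul_iff {θ : WienerSpace} (hθ : θ ∈ cameronMartinSpace)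
    {g : ℝ → ℝ} (hg : UnitL2 g) (w : WienerSpace) (ε : ℝ) :
    DyadicConverges g (w + ε • θ) ↔ DyadicConverges g w := by
  have ht := tendsto_dyadicIntegral_cameronMartin hθ hg
  unfold DyadicConverges
  simp_rw [dyadicIntegral_add_smul]
  constructor
  · rintro ⟨L, hL⟩
    exact ⟨L - ε * unitInner g θ.velocity, by simpa using hL.sub (ht.const_mul ε)⟩
  · rintro ⟨L, hL⟩
    exact ⟨_, hL.add (ht.const_mul ε)⟩

/-- The slope is constant along the line, so differentiating repeatedly in the direction `θ` treats
it as a scalar. -/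
lemma pathShift_add_smul {θ : WienerSpace} (hθ : θ ∈ cameronMartinSpace)
    {g : ℝ → ℝ} (hg : UnitL2 g) (w : WienerSpace) (ε : ℝ) :
    pathShift g θ (w + ε • θ) = pathShift g θ w := by
  unfold pathShift
  congr 1
  exact propext (dyadicConverges_add_smul_iff hθ hg w ε)

/-! ### Dyadic increments under the Wiener measure -/

/-- The increment of a path over the `k`-th dyadic interval of level `n`. -/
noncomputable def dyadicIncrement (n k : ℕ) (w : WienerSpace) : ℝ :=
  w.path (((k : ℝ) + 1) / 2 ^ n) - w.path ((k : ℝ) / 2 ^ n)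

/-- The linear combination of the dyadic increments of level `n` with coefficients `a`. -/
noncomputable def incrementSum (n : ℕ) (a : ℕ → ℝ) (w : WienerSpace) : ℝ :=
  ∑ k ∈ Finset.range (2 ^ n), a k * dyadicIncrement n k w

/-- The mean values of `g` over the dyadic intervals of level `n`. -/
noncomputable def dyadicMean (g : ℝ → ℝ) (n k : ℕ) : ℝ :=
  2 ^ n * ∫ t in ((k : ℝ) / 2 ^ n)..(((k : ℝ) + 1) / 2 ^ n), g t

lemma dyadicIntegral_eq_incrementSum (g : ℝ → ℝ) (n : ℕ) :
    dyadicIntegral g n = incrementSum n (dyadicMean g n) := rfl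

lemma WienerSpace.continuous_path (t : ℝ) : Continuous fun w : WienerSpace => w.path t :=
  (ContinuousEvalConst.continuous_eval_const _).comp continuous_subtype_val

@[fun_prop]
lemma measurable_dyadicIncrement (n k : ℕ) : Measurable (dyadicIncrement n k) :=
  ((WienerSpace.continuous_path _).sub (WienerSpace.continuous_path _)).measurable

@[fun_prop]
lemma measurable_incrementSum (n : ℕ) (a : ℕ → ℝ) : Measurable (incrementSum n a) :=
  Finset.measurable_sum _ fun k _ => (measurable_dyadicIncrement n k).const_mul (a k)

lemma sum_range_two_mul (f : ℕ → ℝ) (m : ℕ) :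
    ∑ i ∈ Finset.range (2 * m), f i = ∑ k ∈ Finset.range m, (f (2 * k) + f (2 * k + 1)) := by
  induction m with
  | zero => simp
  | succ m ih =>
    rw [mul_add, mul_one, Finset.sum_range_succ, Finset.sum_range_succ, ih,
      Finset.sum_range_succ]
    ring

lemma dyadicIncrement_eq_add (n k : ℕ) (w : WienerSpace) :
    dyadicIncrement n k w
      = dyadicIncrement (n + 1) (2 * k) w + dyadicIncrement (n + 1) (2 * k + 1) w := by
  have h1 : ((k : ℝ) + 1) / 2 ^ n = ((2 * k + 1 : ℕ) + 1 : ℝ) / 2 ^ (n + 1) := by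
    push_cast
    field_simp
    ring
  have h2 : (k : ℝ) / 2 ^ n = ((2 * k : ℕ) : ℝ) / 2 ^ (n + 1) := by
    push_cast
    rw [pow_succ]
    field_simp
  unfold dyadicIncrement
  rw [h1, h2]
  push_cast
  ring

/-- The cell `k` splits into the cells `2 * k` and `2 * k + 1`, so `i / 2` is the parent of `i` and
both children inherit its coefficient. -/
lemma incrementSum_succ (n : ℕ) (a : ℕ → ℝ) (w : WienerSpace) :
    incrementSum n a w = incrementSum (n + 1) (fun i => a (i / 2)) w := by
  unfold incrementSum
  rw [pow_succ', sum_range_two_mul]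
  refine Finset.sum_congr rfl fun k _ => ?_
  have h1 : (2 * k) / 2 = k := by omega
  have h2 : (2 * k + 1) / 2 = k := by omega
  simp only [h1, h2]
  rw [dyadicIncrement_eq_add, mul_add]

lemma incrementSum_sub (n : ℕ) (a b : ℕ → ℝ) (w : WienerSpace) :
    incrementSum n a w - incrementSum n b w = incrementSum n (fun k => a k - b k) w := by
  unfold incrementSum
  rw [← Finset.sum_sub_distrib]
  exact Finset.sum_congr rfl fun k _ => by ring

lemma dyadicIncrement_eq_incrementSum {n k : ℕ} (hk : k < 2 ^ n) (w : WienerSpace) :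
    dyadicIncrement n k w = incrementSum n (fun i => if i = k then 1 else 0) w := by
  simp [incrementSum, hk]

lemma UnitL2.dyadicMean_succ {g : ℝ → ℝ} (hg : UnitL2 g) {n k : ℕ} (hk : k < 2 ^ n) :
    dyadicMean g (n + 1) (2 * k) + dyadicMean g (n + 1) (2 * k + 1) = 2 * dyadicMean g n k := by
  have h2 : (k : ℝ) / 2 ^ n = ((2 * k : ℕ) : ℝ) / 2 ^ (n + 1) := by
    push_cast
    rw [pow_succ]
    field_simp
  have h3 : (((2 * k : ℕ) : ℝ) + 1) / 2 ^ (n + 1) = ((2 * k + 1 : ℕ) : ℝ) / 2 ^ (n + 1) := by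
    push_cast
    rfl
  have h1 : ((k : ℝ) + 1) / 2 ^ n = ((2 * k + 1 : ℕ) + 1 : ℝ) / 2 ^ (n + 1) := by
    push_cast
    field_simp
    ring
  have m1 : 2 * k ∈ Finset.range (2 ^ (n + 1)) := by
    rw [Finset.mem_range, pow_succ']
    omega
  have m2 : 2 * k + 1 ∈ Finset.range (2 ^ (n + 1)) := by
    rw [Finset.mem_range, pow_succ']
    omega
  obtain ⟨p1, p2, p3⟩ := dyadic_bounds m1
  obtain ⟨q1, q2, q3⟩ := dyadic_bounds m2
  have hi1 := hg.intervalIntegrable p1 p2 p3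
  have hi2 := hg.intervalIntegrable q1 q2 q3
  rw [h3] at hi1
  unfold dyadicMean
  rw [h1, h2, h3, ← intervalIntegral.integral_add_adjacent_intervals hi1 hi2]
  ring

/-- The linear functional with coefficients `a` on vectors indexed by the dyadic intervals. -/
noncomputable def coeffFunctional (n : ℕ) (a : ℕ → ℝ) : (Fin (2 ^ n) → ℝ) →L[ℝ] ℝ :=
  ∑ k : Fin (2 ^ n), a k • (ContinuousLinearMap.proj k : (Fin (2 ^ n) → ℝ) →L[ℝ] ℝ)

lemma coeffFunctional_dyadicIncrements (n : ℕ) (a : ℕ → ℝ) (w : WienerSpace) :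
    coeffFunctional n a (fun k => dyadicIncrement n k w) = incrementSum n a w := by
  simp [coeffFunctional, incrementSum, Finset.sum_range]

section WienerMeasure

variable {γ : Measure WienerSpace}

lemma IsWienerMeasure.iIndepFun_dyadicIncrement (hγ : IsWienerMeasure γ) (n : ℕ) :
    iIndepFun (dyadicIncrement n) γ := by
  -- Beyond `k = 2 ^ n` the projection stays at `1`, so the whole sequence indexed by `ℕ` is
  -- monotone and the surplus increments vanish.
  have hmono : Monotone fun k : ℕ => Set.projIcc (0 : ℝ) 1 zero_le_one ((k : ℝ) / 2 ^ n) := by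
    intro i j hij
    refine Set.monotone_projIcc _ ?_
    gcongr
  have h := hγ.hasIndepIncrements.nat hmono
  convert! h using 3 with k w
  simp [dyadicIncrement, WienerSpace.path]

lemma IsWienerMeasure.hasLaw_dyadicIncrement (hγ : IsWienerMeasure γ) {n k : ℕ} (hk : k < 2 ^ n) :
    HasLaw (dyadicIncrement n k) (gaussianReal 0 (Real.toNNReal (1 / 2 ^ n))) γ := by
  obtain ⟨h0, h1, h2⟩ := dyadic_bounds (Finset.mem_range.2 hk)
  have h := hγ.hasLaw_increment _ _ (Set.monotone_projIcc zero_le_one h1)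
  rw [Set.projIcc_of_mem _ ⟨h0, h1.trans h2⟩, Set.projIcc_of_mem _ ⟨h0.trans h1, h2⟩] at h
  rw [← dyadic_length n k]
  convert! h using 2 with w
  simp only [dyadicIncrement, WienerSpace.path]
  rw [Set.projIcc_of_mem _ ⟨h0, h1.trans h2⟩, Set.projIcc_of_mem _ ⟨h0.trans h1, h2⟩]

lemma IsWienerMeasure.hasGaussianLaw_dyadicIncrements (hγ : IsWienerMeasure γ) (n : ℕ) :
    HasGaussianLaw (fun w (k : Fin (2 ^ n)) => dyadicIncrement n k w) γ :=
  iIndepFun.hasGaussianLaw (X := fun k : Fin (2 ^ n) => dyadicIncrement n k)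
    (fun k => (hγ.hasLaw_dyadicIncrement k.2).hasGaussianLaw)
    ((hγ.iIndepFun_dyadicIncrement n).precomp Fin.val_injective)

lemma IsWienerMeasure.memLp_dyadicIncrement (hγ : IsWienerMeasure γ) {n k : ℕ} (hk : k < 2 ^ n) :
    MemLp (dyadicIncrement n k) 2 γ :=
  (hγ.hasLaw_dyadicIncrement hk).hasGaussianLaw.memLp_two

lemma IsWienerMeasure.covariance_dyadicIncrement (hγ : IsWienerMeasure γ) {n j k : ℕ}
    (hj : j < 2 ^ n) (hk : k < 2 ^ n) :
    cov[dyadicIncrement n j, dyadicIncrement n k; γ] = if j = k then 1 / 2 ^ n else 0 := by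
  split_ifs with h
  · subst h
    rw [covariance_self (by fun_prop), (hγ.hasLaw_dyadicIncrement hj).variance_eq,
      variance_id_gaussianReal, Real.coe_toNNReal _ (by positivity)]
  · have := hγ.isProbabilityMeasure
    exact ((hγ.iIndepFun_dyadicIncrement n).indepFun h).covariance_eq_zero
      (hγ.memLp_dyadicIncrement hj) (hγ.memLp_dyadicIncrement hk)

lemma IsWienerMeasure.covariance_incrementSum (hγ : IsWienerMeasure γ) (n : ℕ) (a b : ℕ → ℝ) :
    cov[incrementSum n a, incrementSum n b; γ]
      = (∑ k ∈ Finset.range (2 ^ n), a k * b k) / 2 ^ n := by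
  have := hγ.isProbabilityMeasure
  have hm : ∀ c : ℕ → ℝ, ∀ k ∈ Finset.range (2 ^ n),
      MemLp (fun w => c k * dyadicIncrement n k w) 2 γ := fun c k hk =>
    (hγ.memLp_dyadicIncrement (Finset.mem_range.1 hk)).const_mul (c k)
  unfold incrementSum
  rw [covariance_fun_sum_fun_sum' (hm a) (hm b), Finset.sum_div]
  refine Finset.sum_congr rfl fun j hj => ?_
  rw [Finset.sum_eq_single_of_mem j hj]
  · rw [covariance_const_mul_left, covariance_const_mul_right,
      hγ.covariance_dyadicIncrement (Finset.mem_range.1 hj) (Finset.mem_range.1 hj), if_pos rfl]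
    ring
  · intro k hk hkj
    rw [covariance_const_mul_left, covariance_const_mul_right,
      hγ.covariance_dyadicIncrement (Finset.mem_range.1 hj) (Finset.mem_range.1 hk),
      if_neg hkj.symm]
    ring

lemma IsWienerMeasure.hasGaussianLaw_incrementSum (hγ : IsWienerMeasure γ) (n : ℕ) (a : ℕ → ℝ) :
    HasGaussianLaw (incrementSum n a) γ := by
  have h := (hγ.hasGaussianLaw_dyadicIncrements n).map_fun
    (coeffFunctional n a)
  convert! h using 1
  ext w
  exact (coeffFunctional_dyadicIncrements n a w).symm

lemma IsWienerMeasure.integral_incrementSum (hγ : IsWienerMeasure γ) (n : ℕ) (a : ℕ → ℝ) :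
    ∫ w, incrementSum n a w ∂γ = 0 := by
  unfold incrementSum
  rw [integral_finsetSum]
  · refine Finset.sum_eq_zero fun k hk => ?_
    rw [integral_const_mul, (hγ.hasLaw_dyadicIncrement (Finset.mem_range.1 hk)).integral_eq,
      integral_id_gaussianReal, mul_zero]
  · intro k hk
    exact ((hγ.hasLaw_dyadicIncrement (Finset.mem_range.1 hk)).hasGaussianLaw.integrable).const_mul _

lemma IsWienerMeasure.variance_dyadicIntegral (hγ : IsWienerMeasure γ) (g : ℝ → ℝ) (n : ℕ) :
    Var[dyadicIntegral g n; γ] = dyadicForm n g g := by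
  rw [dyadicIntegral_eq_incrementSum, ← covariance_self (by fun_prop),
    hγ.covariance_incrementSum, dyadicForm, Finset.sum_div]
  refine Finset.sum_congr rfl fun k _ => ?_
  unfold dyadicMean
  field_simp

lemma IsWienerMeasure.map_dyadicIntegral (hγ : IsWienerMeasure γ) (g : ℝ → ℝ) (n : ℕ) :
    γ.map (dyadicIntegral g n) = gaussianReal 0 (Real.toNNReal (dyadicForm n g g)) := by
  have h := (hγ.hasGaussianLaw_incrementSum n (dyadicMean g n)).map_eq_gaussianReal
  rw [hγ.integral_incrementSum, ← dyadicIntegral_eq_incrementSum, hγ.variance_dyadicIntegral] at h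
  exact h

/-- A coarse increment gives equal weight to two siblings, on which `d` cancels; the covariances are
therefore `0`, and for jointly Gaussian variables this means independence. -/
lemma IsWienerMeasure.indepFun_incrementSum_dyadicIncrements (hγ : IsWienerMeasure γ) {n : ℕ}
    {d : ℕ → ℝ} (hd : ∀ k < 2 ^ n, d (2 * k) + d (2 * k + 1) = 0) :
    IndepFun (incrementSum (n + 1) d) (fun w (k : Fin (2 ^ n)) => dyadicIncrement n k w) γ := by
  have hinc : ∀ (k : Fin (2 ^ n)), dyadicIncrement n k
      = incrementSum (n + 1) (fun i => if i / 2 = (k : ℕ) then 1 else 0) := by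
    intro k
    ext w
    rw [dyadicIncrement_eq_incrementSum k.2, incrementSum_succ]
  have hjoint : HasGaussianLaw (fun w => (fun _ : Unit => incrementSum (n + 1) d w,
      fun k : Fin (2 ^ n) => dyadicIncrement n k w)) γ := by
    have h := (hγ.hasGaussianLaw_dyadicIncrements (n + 1)).map_fun
      ((ContinuousLinearMap.pi fun _ : Unit => coeffFunctional (n + 1) d).prod
        (ContinuousLinearMap.pi fun k : Fin (2 ^ n) =>
          coeffFunctional (n + 1) fun i => if i / 2 = (k : ℕ) then 1 else 0))
    convert! h using 2 with w
    simp only [hinc, ContinuousLinearMap.prod_apply, ContinuousLinearMap.coe_pi',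
      coeffFunctional_dyadicIncrements]
  have h := hjoint.indepFun_of_covariance_eval (X := fun _ : Unit => incrementSum (n + 1) d)
    (Y := fun k : Fin (2 ^ n) => dyadicIncrement n k) fun _ k => by
      rw [hinc, hγ.covariance_incrementSum, pow_succ', sum_range_two_mul]
      refine div_eq_zero_iff.2 (Or.inl (Finset.sum_eq_zero fun j hj => ?_))
      have h1 : (2 * j) / 2 = j := by omega
      have h2 : (2 * j + 1) / 2 = j := by omega
      rw [h1, h2, ← add_mul, hd j (Finset.mem_range.1 hj), zero_mul]
  have hm : Measurable fun x : Unit → ℝ => x () := measurable_pi_apply ()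
  exact h.comp hm measurable_id

/-- The `σ`-field generated by the dyadic increments of level `n`. -/
noncomputable abbrev dyadicSigma (n : ℕ) : MeasurableSpace WienerSpace :=
  MeasurableSpace.comap (fun w (k : Fin (2 ^ n)) => dyadicIncrement n k w) MeasurableSpace.pi

lemma measurable_dyadicSigma_incrementSum (n : ℕ) (a : ℕ → ℝ) :
    Measurable[dyadicSigma n] (incrementSum n a) := by
  have h := (coeffFunctional n a).measurable.comp
    (comap_measurable fun w (k : Fin (2 ^ n)) => dyadicIncrement n k w)
  convert! h using 1
  ext w
  exact (coeffFunctional_dyadicIncrements n a w).symm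

/-- The filtration generated by the dyadic increments. -/
noncomputable def dyadicFiltration : Filtration ℕ WienerSpace.measurableSpace where
  seq := dyadicSigma
  mono' := by
    refine monotone_nat_of_le_succ fun n => ?_
    have hT : Measurable fun (x : Fin (2 ^ (n + 1)) → ℝ) (k : Fin (2 ^ n)) =>
        coeffFunctional (n + 1) (fun i => if i / 2 = (k : ℕ) then 1 else 0) x :=
      measurable_pi_lambda _ fun k => (coeffFunctional (n + 1) _).measurable
    have h := hT.comp
      (comap_measurable fun w (k : Fin (2 ^ (n + 1))) => dyadicIncrement (n + 1) k w)
    convert! h.comap_le using 2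
    ext w k
    simp only [Function.comp_apply, coeffFunctional_dyadicIncrements]
    rw [dyadicIncrement_eq_incrementSum k.2, incrementSum_succ]
  le' n := (measurable_pi_lambda _ fun k : Fin (2 ^ n) => measurable_dyadicIncrement n k).comap_le

/-- The dyadic approximations of a Wiener integral form a martingale. -/
lemma IsWienerMeasure.martingale_dyadicIntegral (hγ : IsWienerMeasure γ) {g : ℝ → ℝ}
    (hg : UnitL2 g) : Martingale (fun n => dyadicIntegral g n) dyadicFiltration γ := by
  have := hγ.isProbabilityMeasure
  refine martingale_of_condExp_sub_eq_zero_nat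
    (fun n => (measurable_dyadicSigma_incrementSum n _).stronglyMeasurable)
    (fun n => (hγ.hasGaussianLaw_incrementSum n _).integrable) fun n => ?_
  -- The martingale difference has as coefficients the fine means minus the parent means. They
  -- cancel on siblings because a mean is the average of the means over the two halves, so the
  -- difference is independent of the past and centered.
  set d : ℕ → ℝ := fun k => dyadicMean g (n + 1) k - dyadicMean g n (k / 2) with hd
  have hD : dyadicIntegral g (n + 1) - dyadicIntegral g n = incrementSum (n + 1) d := by
    ext w
    rw [Pi.sub_apply, dyadicIntegral_eq_incrementSum, dyadicIntegral_eq_incrementSum,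
      incrementSum_succ n, incrementSum_sub]
  have hind := hγ.indepFun_incrementSum_dyadicIncrements (n := n) (d := d) fun k hk => by
    have h1 : (2 * k) / 2 = k := by omega
    have h2 : (2 * k + 1) / 2 = k := by omega
    have := hg.dyadicMean_succ hk
    simp only [hd, h1, h2]
    linarith
  rw [hD]
  have h := condExp_indep_eq (μ := γ) (f := incrementSum (n + 1) d)
    (m₁ := MeasurableSpace.comap (incrementSum (n + 1) d) inferInstance)
    (m₂ := dyadicFiltration n)
    (measurable_iff_comap_le.1 (measurable_incrementSum (n + 1) d)) (dyadicFiltration.le n)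
    (comap_measurable _).stronglyMeasurable hind
  rw [hγ.integral_incrementSum] at h
  exact h

/-- Martingale convergence: the `L¹` norms are at most the `L²` norms, which are bounded by the norm
of `g` because averaging is a contraction. -/
lemma IsWienerMeasure.ae_dyadicConverges (hγ : IsWienerMeasure γ) {g : ℝ → ℝ} (hg : UnitL2 g) :
    ∀ᵐ w ∂γ, DyadicConverges g w := by
  have := hγ.isProbabilityMeasure
  have hbdd : ∀ n, eLpNorm (dyadicIntegral g n) 1 γ
      ≤ (Real.toNNReal (√(unitInner g g)) : ENNReal) := by
    intro n
    have hG := hγ.hasGaussianLaw_incrementSum n (dyadicMean g n)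
    rw [← dyadicIntegral_eq_incrementSum] at hG
    refine (eLpNorm_le_eLpNorm_of_exponent_le (by norm_num : (1 : ENNReal) ≤ 2)
      hG.aemeasurable.aestronglyMeasurable).trans ?_
    rw [hG.memLp_two.eLpNorm_eq_integral_rpow_norm (by norm_num) (by norm_num)]
    refine ENNReal.ofReal_le_ofReal ?_
    have hv : ∫ w, dyadicIntegral g n w ^ 2 ∂γ = dyadicForm n g g := by
      rw [← hγ.variance_dyadicIntegral, variance_of_integral_eq_zero hG.aemeasurable]
      exact hγ.integral_incrementSum n _
    simp only [Real.norm_eq_abs, ENNReal.toReal_ofNat, Real.rpow_ofNat, sq_abs]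
    rw [hv, ← one_div, ← Real.sqrt_eq_rpow]
    exact Real.sqrt_le_sqrt (hg.dyadicForm_le n)
  exact (hγ.martingale_dyadicIntegral hg).submartingale.exists_ae_tendsto_of_bdd hbdd

lemma IsWienerMeasure.aemeasurable_wienerIntegral (hγ : IsWienerMeasure γ) {g : ℝ → ℝ}
    (hg : UnitL2 g) : AEMeasurable (wienerIntegral g) γ :=
  aemeasurable_of_tendsto_metrizable_ae atTop
    (fun n => (measurable_incrementSum n (dyadicMean g n)).aemeasurable)
    (by filter_upwards [hγ.ae_dyadicConverges hg] with w hw using hw.tendsto)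

lemma unitInner_self_nonneg (g : ℝ → ℝ) : 0 ≤ unitInner g g :=
  intervalIntegral.integral_nonneg zero_le_one fun _ _ => mul_self_nonneg _

/-- The Wiener integral of `g` is centered Gaussian, with the squared norm of `g` as variance. -/
lemma IsWienerMeasure.map_wienerIntegral (hγ : IsWienerMeasure γ) {g : ℝ → ℝ} (hg : UnitL2 g) :
    γ.map (wienerIntegral g) = gaussianReal 0 (Real.toNNReal (unitInner g g)) := by
  have := hγ.isProbabilityMeasure
  have hm := hγ.aemeasurable_wienerIntegral hg
  have := Measure.isProbabilityMeasure_map hm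
  refine Measure.ext_of_charFun (funext fun t => ?_)
  -- The characteristic functions have two limits: by dominated convergence from almost sure
  -- convergence, and by convergence of the variances.
  have h1 : Tendsto (fun n => charFun (γ.map (dyadicIntegral g n)) t) atTop
      (𝓝 (charFun (γ.map (wienerIntegral g)) t)) := by
    simp_rw [charFun_apply_real]
    rw [integral_map hm (by fun_prop)]
    have : ∀ n, ∫ x, Complex.exp (t * x * Complex.I) ∂(γ.map (dyadicIntegral g n))
        = ∫ w, Complex.exp (t * dyadicIntegral g n w * Complex.I) ∂γ := fun n =>
      integral_map (measurable_incrementSum n (dyadicMean g n)).aemeasurable (by fun_prop)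
    simp_rw [this]
    refine tendsto_integral_of_dominated_convergence (fun _ => 1) (fun n => ?_)
      (integrable_const _) (fun n => ?_) ?_
    · have := measurable_incrementSum n (dyadicMean g n)
      rw [← dyadicIntegral_eq_incrementSum] at this
      exact Measurable.aestronglyMeasurable (by fun_prop)
    · refine ae_of_all _ fun w => ?_
      rw [← Complex.ofReal_mul, Complex.norm_exp_ofReal_mul_I]
    · filter_upwards [hγ.ae_dyadicConverges hg] with w hw
      have hc : Continuous fun x : ℝ => Complex.exp (t * x * Complex.I) := by fun_prop
      exact (hc.tendsto _).comp hw.tendsto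
  have h2 : Tendsto (fun n => charFun (γ.map (dyadicIntegral g n)) t) atTop
      (𝓝 (charFun (gaussianReal 0 (Real.toNNReal (unitInner g g))) t)) := by
    simp_rw [hγ.map_dyadicIntegral, charFun_gaussianReal,
      Real.coe_toNNReal _ (dyadicForm_self_nonneg _ g), Real.coe_toNNReal _ (unitInner_self_nonneg g)]
    have hc : Continuous fun v : ℝ =>
        Complex.exp (t * (0 : ℝ) * Complex.I - v * t ^ 2 / 2) := by fun_prop
    exact (hc.tendsto _).comp hg.tendsto_dyadicForm_self
  exact tendsto_nhds_unique h1 h2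

end WienerMeasure

/-! ### The Cameron-Martin formula for Wiener integrals -/

lemma UnitL2.unitInner_add_left {f g h : ℝ → ℝ} (hf : UnitL2 f) (hg : UnitL2 g) (hh : UnitL2 h) :
    unitInner (fun t => f t + g t) h = unitInner f h + unitInner g h := by
  unfold unitInner
  rw [← intervalIntegral.integral_add (hf.intervalIntegrable_mul hh le_rfl zero_le_one le_rfl)
    (hg.intervalIntegrable_mul hh le_rfl zero_le_one le_rfl)]
  simp only [add_mul]

lemma unitInner_const_mul_left (c : ℝ) (f g : ℝ → ℝ) :
    unitInner (fun t => c * f t) g = c * unitInner f g := by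
  unfold unitInner
  rw [← intervalIntegral.integral_const_mul]
  simp only [mul_assoc]

lemma unitInner_comm (f g : ℝ → ℝ) : unitInner f g = unitInner g f := by
  simp only [unitInner, mul_comm]

lemma UnitL2.unitInner_self_mul_add {f g : ℝ → ℝ} (hf : UnitL2 f) (hg : UnitL2 g) (c : ℝ) :
    unitInner (fun t => c * f t + g t) (fun t => c * f t + g t)
      = c ^ 2 * unitInner f f + 2 * c * unitInner f g + unitInner g g := by
  have hcf : UnitL2 fun t => c * f t := hf.const_mul c
  have hs : UnitL2 fun t => c * f t + g t := hcf.add hg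
  rw [hcf.unitInner_add_left hg hs, unitInner_const_mul_left, unitInner_comm f, unitInner_comm g,
    hcf.unitInner_add_left hg hf, hcf.unitInner_add_left hg hg, unitInner_const_mul_left,
    unitInner_const_mul_left, unitInner_comm g f]
  ring

lemma UnitL2.finset_sum {ι : Type*} {g : ι → ℝ → ℝ} (hg : ∀ i, UnitL2 (g i)) (t : ι → ℝ)
    (s : Finset ι) : UnitL2 fun x => ∑ i ∈ s, t i * g i x :=
  memLp_finsetSum s fun i _ => (hg i).const_mul (t i)

lemma UnitL2.unitInner_finset_sum {ι : Type*} {g : ι → ℝ → ℝ} (hg : ∀ i, UnitL2 (g i))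
    (t : ι → ℝ) (s : Finset ι) {h : ℝ → ℝ} (hh : UnitL2 h) :
    unitInner (fun x => ∑ i ∈ s, t i * g i x) h = ∑ i ∈ s, t i * unitInner (g i) h := by
  classical
  induction s using Finset.induction_on with
  | empty => simp [unitInner]
  | insert i s hi ih =>
    simp only [Finset.sum_insert hi]
    have hi' : UnitL2 fun x => t i * g i x := (hg i).const_mul (t i)
    rw [hi'.unitInner_add_left (UnitL2.finset_sum hg t s) hh, ih, unitInner_const_mul_left]

lemma UnitL2.dyadicIntegral_add {f g : ℝ → ℝ} (hf : UnitL2 f) (hg : UnitL2 g) (n : ℕ)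
    (w : WienerSpace) :
    dyadicIntegral (fun t => f t + g t) n w = dyadicIntegral f n w + dyadicIntegral g n w := by
  simp only [dyadicIntegral]
  rw [← Finset.sum_add_distrib]
  refine Finset.sum_congr rfl fun k hk => ?_
  obtain ⟨h0, h1, h2⟩ := dyadic_bounds hk
  rw [intervalIntegral.integral_add (hf.intervalIntegrable h0 h1 h2)
    (hg.intervalIntegrable h0 h1 h2)]
  ring

lemma dyadicIntegral_const_mul (c : ℝ) (f : ℝ → ℝ) (n : ℕ) (w : WienerSpace) :
    dyadicIntegral (fun t => c * f t) n w = c * dyadicIntegral f n w := by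
  simp only [dyadicIntegral]
  rw [Finset.mul_sum]
  refine Finset.sum_congr rfl fun k _ => ?_
  rw [intervalIntegral.integral_const_mul]
  ring

lemma UnitL2.wienerIntegral_add {f g : ℝ → ℝ} (hf : UnitL2 f) (hg : UnitL2 g)
    {w : WienerSpace} (hfw : DyadicConverges f w) (hgw : DyadicConverges g w) :
    wienerIntegral (fun t => f t + g t) w = wienerIntegral f w + wienerIntegral g w := by
  refine wienerIntegral_eq_of_tendsto ?_
  simp_rw [hf.dyadicIntegral_add hg]
  exact hfw.tendsto.add hgw.tendsto

lemma wienerIntegral_const_mul (c : ℝ) {f : ℝ → ℝ} {w : WienerSpace} (hfw : DyadicConverges f w) :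
    wienerIntegral (fun t => c * f t) w = c * wienerIntegral f w := by
  refine wienerIntegral_eq_of_tendsto ?_
  simp_rw [dyadicIntegral_const_mul]
  exact hfw.tendsto.const_mul c

section WienerMeasure

variable {γ : Measure WienerSpace}

lemma IsWienerMeasure.wienerIntegral_mul_add (hγ : IsWienerMeasure γ) {f g : ℝ → ℝ}
    (hf : UnitL2 f) (hg : UnitL2 g) (c : ℝ) :
    wienerIntegral (fun t => c * f t + g t)
      =ᵐ[γ] fun w => c * wienerIntegral f w + wienerIntegral g w := by
  have hcf : UnitL2 fun t => c * f t := hf.const_mul c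
  filter_upwards [hγ.ae_dyadicConverges hf, hγ.ae_dyadicConverges hcf, hγ.ae_dyadicConverges hg]
    with w h1 h2 h3
  rw [hcf.wienerIntegral_add hg h2 h3, wienerIntegral_const_mul c h1]

lemma IsWienerMeasure.wienerIntegral_finset_sum (hγ : IsWienerMeasure γ) {ι : Type*}
    {g : ι → ℝ → ℝ} (hg : ∀ i, UnitL2 (g i)) (t : ι → ℝ) (s : Finset ι) :
    wienerIntegral (fun x => ∑ i ∈ s, t i * g i x)
      =ᵐ[γ] fun w => ∑ i ∈ s, t i * wienerIntegral (g i) w := by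
  classical
  induction s using Finset.induction_on with
  | empty =>
    refine ae_of_all _ fun w => wienerIntegral_eq_of_tendsto ?_
    simp [dyadicIntegral]
  | insert i s hi ih =>
    simp only [Finset.sum_insert hi]
    filter_upwards [ih, hγ.wienerIntegral_mul_add (hg i) (UnitL2.finset_sum hg t s) (t i)]
      with w h1 h2
    rw [h2, h1]

/-! ### Exponential moments and laws under the exponentially tilted measure. -/

lemma IsWienerMeasure.mgf_wienerIntegral (hγ : IsWienerMeasure γ) {g : ℝ → ℝ} (hg : UnitL2 g)
    (t : ℝ) : mgf (wienerIntegral g) γ t = Real.exp (unitInner g g * t ^ 2 / 2) := by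
  rw [mgf_gaussianReal (hγ.map_wienerIntegral hg), Real.coe_toNNReal _ (unitInner_self_nonneg g)]
  simp

lemma IsWienerMeasure.integral_exp_wienerIntegral (hγ : IsWienerMeasure γ) {g : ℝ → ℝ}
    (hg : UnitL2 g) :
    ∫ w, Real.exp (wienerIntegral g w) ∂γ = Real.exp (1 / 2 * unitInner g g) := by
  have h := hγ.mgf_wienerIntegral hg 1
  simp only [mgf, one_mul] at h
  rw [h]
  ring_nf

lemma IsWienerMeasure.integrable_exp_wienerIntegral (hγ : IsWienerMeasure γ) {g : ℝ → ℝ}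
    (hg : UnitL2 g) : Integrable (fun w => Real.exp (wienerIntegral g w)) γ := by
  -- A non-integrable function would have integral `0` by convention, but the integral is an
  -- exponential.
  by_contra h
  have h1 := hγ.integral_exp_wienerIntegral hg
  rw [integral_undef h] at h1
  exact (Real.exp_pos _).ne h1

/-- A real random variable with the moment generating function of a Gaussian one is Gaussian. -/
lemma map_eq_gaussianReal_of_mgf {Ω : Type*} {mΩ : MeasurableSpace Ω} {P : Measure Ω}
    [IsProbabilityMeasure P] {X : Ω → ℝ} (hX : AEMeasurable X P) {m : ℝ} {v : NNReal}
    (h : ∀ t, mgf X P t = Real.exp (m * t + v * t ^ 2 / 2)) : P.map X = gaussianReal m v := by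
  have hmgf : mgf id (gaussianReal m v) = mgf X P := by
    ext t
    rw [h, mgf_id_gaussianReal]
  -- Analytic continuation: the Gaussian moment generating function is finite on all of `ℝ`, so the
  -- equality extends to all of `ℂ`, where the complex version determines the law.
  have heq := eqOn_complexMGF_of_mgf hmgf
  rw [integrableExpSet_id_gaussianReal] at heq
  have h := Measure.ext_of_complexMGF_eq aemeasurable_id hX
    (funext fun z => heq (by simp : z.re ∈ interior Set.univ))
  rw [Measure.map_id] at h
  exact h.symm

/-- The measure with the Cameron-Martin density shifts the mean of a Wiener integral. -/
lemma IsWienerMeasure.map_tilted_wienerIntegral (hγ : IsWienerMeasure γ) {f g : ℝ → ℝ}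
    (hf : UnitL2 f) (hg : UnitL2 g) :
    (γ.tilted (wienerIntegral f)).map (wienerIntegral g)
      = gaussianReal (unitInner g f) (Real.toNNReal (unitInner g g)) := by
  have := hγ.isProbabilityMeasure
  have := isProbabilityMeasure_tilted (hγ.integrable_exp_wienerIntegral hf)
  refine map_eq_gaussianReal_of_mgf
    ((hγ.aemeasurable_wienerIntegral hg).mono_ac (tilted_absolutelyContinuous _ _)) fun t => ?_
  have hs : UnitL2 fun x => t * g x + f x := (hg.const_mul t).add hf
  rw [mgf, integral_tilted, hγ.integral_exp_wienerIntegral hf,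
    Real.coe_toNNReal _ (unitInner_self_nonneg g)]
  -- By linearity the two exponents merge into the Wiener integral of `t * g + f`. Then `½‖t g + f‖²
  -- - ½‖f‖² = t ⟨g, f⟩ + ½ t² ‖g‖²` exhibits the shifted mean.
  have h1 : ∫ w, (Real.exp (wienerIntegral f w) / Real.exp (1 / 2 * unitInner f f)) •
      Real.exp (t * wienerIntegral g w) ∂γ
      = ∫ w, Real.exp (wienerIntegral (fun x => t * g x + f x) w) /
        Real.exp (1 / 2 * unitInner f f) ∂γ := by
    refine integral_congr_ae ?_
    filter_upwards [hγ.wienerIntegral_mul_add hg hf t] with w hw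
    rw [hw, Real.exp_add, smul_eq_mul]
    ring
  rw [h1, integral_div, hγ.integral_exp_wienerIntegral hs, hg.unitInner_self_mul_add hf,
    ← Real.exp_sub]
  ring_nf

/-- The joint law of Wiener integrals under the Cameron-Martin density. -/
lemma IsWienerMeasure.map_tilted_eq_map_add (hγ : IsWienerMeasure γ) {ι : Type*} [Fintype ι]
    {f : ℝ → ℝ} (hf : UnitL2 f) {g : ι → ℝ → ℝ} (hg : ∀ i, UnitL2 (g i)) :
    (γ.tilted (wienerIntegral f)).map (fun w i => wienerIntegral (g i) w)
      = γ.map (fun w i => wienerIntegral (g i) w + unitInner (g i) f) := by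
  classical
  have := hγ.isProbabilityMeasure
  have := isProbabilityMeasure_tilted (hγ.integrable_exp_wienerIntegral hf)
  have hac := tilted_absolutelyContinuous γ (wienerIntegral f)
  have hm : AEMeasurable (fun w i => wienerIntegral (g i) w) γ :=
    aemeasurable_pi_lambda _ fun i => hγ.aemeasurable_wienerIntegral (hg i)
  have hm1 := hm.mono_ac hac
  have hm2 : AEMeasurable (fun w i => wienerIntegral (g i) w + unitInner (g i) f) γ :=
    aemeasurable_pi_lambda _ fun i => (hγ.aemeasurable_wienerIntegral (hg i)).add_const _
  have := Measure.isProbabilityMeasure_map hm1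
  have := Measure.isProbabilityMeasure_map hm2
  -- Cramér-Wold: the law of a vector is determined by those of its images under linear functionals
  -- `L`, and `L` of the vector is almost surely the Wiener integral of the single function `G`.
  refine Measure.ext_of_charFunDual (funext fun L => ?_)
  rw [charFunDual_eq_charFun_map_one, charFunDual_eq_charFun_map_one]
  congr 1
  set t : ι → ℝ := fun i => L (Pi.single i 1) with ht
  have hL : ∀ x : ι → ℝ, L x = ∑ i, t i * x i := by
    intro x
    conv_lhs => rw [pi_eq_sum_univ' x]
    simp [ht, mul_comm]
  set G : ℝ → ℝ := fun x => ∑ i, t i * g i x with hG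
  have hGL : UnitL2 G := UnitL2.finset_sum hg t _
  have hsum := hγ.wienerIntegral_finset_sum hg t Finset.univ
  have hLm : Measurable L := L.continuous.measurable
  rw [AEMeasurable.map_map_of_aemeasurable hLm.aemeasurable hm1,
    AEMeasurable.map_map_of_aemeasurable hLm.aemeasurable hm2]
  have e1 : (L ∘ fun w i => wienerIntegral (g i) w) =ᵐ[γ.tilted (wienerIntegral f)]
      wienerIntegral G := by
    filter_upwards [hac.ae_le hsum] with w hw
    rw [Function.comp_apply, hL, hw]
  have e2 : (L ∘ fun w i => wienerIntegral (g i) w + unitInner (g i) f) =ᵐ[γ]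
      fun w => wienerIntegral G w + unitInner G f := by
    filter_upwards [hsum] with w hw
    rw [Function.comp_apply, hL, hw, UnitL2.unitInner_finset_sum hg t _ hf,
      ← Finset.sum_add_distrib]
    exact Finset.sum_congr rfl fun i _ => by ring
  rw [Measure.map_congr e1, Measure.map_congr e2, hγ.map_tilted_wienerIntegral hf hGL]
  have h := gaussianReal_map_add_const (μ := 0) (v := Real.toNNReal (unitInner G G))
    (unitInner G f)
  rw [← hγ.map_wienerIntegral hGL, AEMeasurable.map_map_of_aemeasurable (by fun_prop)
    (hγ.aemeasurable_wienerIntegral hGL), zero_add] at h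
  exact h.symm

lemma IsWienerMeasure.memLp_wienerIntegral (hγ : IsWienerMeasure γ) {g : ℝ → ℝ} (hg : UnitL2 g)
    {p : ENNReal} (hp : p ≠ ⊤) : MemLp (wienerIntegral g) p γ := by
  have h : HasGaussianLaw (wienerIntegral g) γ :=
    ⟨by rw [hγ.map_wienerIntegral hg]; infer_instance⟩
  exact h.memLp hp

/-- Polynomials in random variables with moments of all orders have moments of all orders. -/
lemma memLp_eval_mvPolynomial {Ω : Type*} {mΩ : MeasurableSpace Ω} {P : Measure Ω}
    [IsFiniteMeasure P] {ι : Type*} {X : ι → Ω → ℝ}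
    (hX : ∀ i (p : ENNReal), p ≠ ⊤ → MemLp (X i) p P) (q : MvPolynomial ι ℝ) :
    ∀ p : ENNReal, p ≠ ⊤ → MemLp (fun ω => MvPolynomial.eval (fun i => X i ω) q) p P := by
  induction q using MvPolynomial.induction_on with
  | C a => simpa using fun p _ => memLp_const a
  | add q r hq hr =>
    intro p hp
    simp only [map_add]
    exact (hq p hp).add (hr p hp)
  | mul_X q i hq =>
    intro p hp
    -- Hölder: a product in `L^p` needs both factors in `L^(2p)`, which is why the induction carries
    -- all finite exponents together.
    have hpp : ENNReal.HolderTriple (2 * p) (2 * p) p := ⟨by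
      rw [ENNReal.mul_inv (by simp) (by simp), ← two_mul, ← mul_assoc,
        ENNReal.mul_inv_cancel (by simp) (by simp), one_mul]⟩
    have h2p : 2 * p ≠ ⊤ := ENNReal.mul_ne_top (by simp) hp
    simp only [map_mul, MvPolynomial.eval_X]
    exact (hX i _ h2p).mul (hq _ h2p)

end WienerMeasure

/-! ### Exponential series along lines -/

lemma lineDifferentiableAt_and_dirDeriv_of_polynomial {θ : WienerSpace} {F : WienerSpace → ℝ}
    {P : Polynomial ℝ} {w : WienerSpace} (h : ∀ ε : ℝ, F (w + ε • θ) = P.eval ε) :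
    LineDifferentiableAt ℝ F w θ ∧ dirDeriv θ F w = P.derivative.eval 0 := by
  have h' : HasLineDerivAt ℝ F (P.derivative.eval 0) w θ := by
    unfold HasLineDerivAt
    simp_rw [h]
    exact P.hasDerivAt 0
  exact ⟨h'.lineDifferentiableAt, h'.lineDeriv⟩

lemma dirDeriv_iterate_of_polynomial {θ : WienerSpace} {F : WienerSpace → ℝ}
    {P : WienerSpace → Polynomial ℝ} (h : ∀ (w : WienerSpace) (ε : ℝ),
      F (w + ε • θ) = (P w).eval ε) (n : ℕ) (w : WienerSpace) (ε : ℝ) :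
    ((dirDeriv θ)^[n] F) (w + ε • θ) = (Polynomial.derivative^[n] (P w)).eval ε := by
  induction n generalizing w ε with
  | zero => exact h w ε
  | succ n ih =>
    rw [Function.iterate_succ_apply', Function.iterate_succ_apply',
      (lineDifferentiableAt_and_dirDeriv_of_polynomial
        -- The same line, reparametrized so that the point of differentiation is at parameter `0`.
        (P := (Polynomial.derivative^[n] (P w)).comp (Polynomial.C ε + Polynomial.X)) ?_).2]
    · rw [Polynomial.derivative_comp]
      simp
    · intro δ
      rw [add_assoc, ← add_smul, ih]
      simp

/-- The terms are the coefficients of `P`, of which only finitely many are nonzero. -/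
lemma hasSum_taylor_polynomial (P : Polynomial ℝ) :
    HasSum (fun n : ℕ => (1 / (n ! : ℝ)) * (Polynomial.derivative^[n] P).eval 0) (P.eval 1) := by
  have h : ∀ n : ℕ, (1 / (n ! : ℝ)) * (Polynomial.derivative^[n] P).eval 0 = P.coeff n := by
    intro n
    rw [← Polynomial.coeff_zero_eq_eval_zero, Polynomial.coeff_iterate_derivative]
    simp only [zero_add, Nat.descFactorial_self, nsmul_eq_mul]
    field_simp
  simp_rw [h]
  rw [Polynomial.eval_eq_sum_range]
  simp only [one_pow, mul_one]
  exact hasSum_sum_of_ne_finset_zero fun n hn =>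
    Polynomial.coeff_eq_zero_of_natDegree_lt (by simpa using hn)

lemma expSeries_dirDeriv_of_polynomial {θ : WienerSpace} {F : WienerSpace → ℝ}
    {P : WienerSpace → Polynomial ℝ} (h : ∀ (w : WienerSpace) (ε : ℝ),
      F (w + ε • θ) = (P w).eval ε) :
    ExpSeriesWellDefined θ (dirDeriv θ) F ∧ expSeries (dirDeriv θ) F = fun w => F (w + θ) := by
  have hD : ∀ n w, ((dirDeriv θ)^[n] F) w = (Polynomial.derivative^[n] (P w)).eval 0 := by
    intro n w
    simpa using dirDeriv_iterate_of_polynomial h n w 0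
  have hs : ∀ w, HasSum (fun n : ℕ => (1 / (n ! : ℝ)) * ((dirDeriv θ)^[n] F) w) (F (w + θ)) := by
    intro w
    simp_rw [hD]
    have := h w 1
    rw [one_smul] at this
    rw [this]
    exact hasSum_taylor_polynomial _
  exact ⟨⟨fun n w => (lineDifferentiableAt_and_dirDeriv_of_polynomial fun ε =>
    dirDeriv_iterate_of_polynomial h n w ε).1, fun w => (hs w).summable⟩,
    funext fun w => (hs w).tsum_eq⟩

/-- The Hermite polynomials with variance parameter `c`. -/
noncomputable def varHermite (c : ℝ) : ℕ → Polynomial ℝ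
  | 0 => 1
  | n + 1 => Polynomial.X * varHermite c n - Polynomial.C c * (varHermite c n).derivative

/-- The generating function of the Hermite polynomials. -/
lemma hasSum_varHermite (c x : ℝ) :
    HasSum (fun n : ℕ => (1 / (n ! : ℝ)) * (varHermite c n).eval x) (Real.exp (x - 1 / 2 * c)) := by
  set G : ℂ → ℂ := fun s => Complex.exp (s * x - s ^ 2 * c / 2) with hG
  have hd : ∀ s : ℂ, HasDerivAt (fun s : ℂ => s * x - s ^ 2 * c / 2) (x - s * c) s := by
    intro s
    have := ((hasDerivAt_id s).mul_const (x : ℂ)).sub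
      ((((hasDerivAt_id s).pow 2).mul_const (c : ℂ)).div_const 2)
    convert! this using 1
    simp
    ring
  have hGd : Differentiable ℂ G := fun s => (hd s).cexp.differentiableAt
  -- Differentiating `Hₙ(x - s c) G(s)` gives `((x - s c) Hₙ - c Hₙ') G`, which is the recurrence.
  -- As `G` is entire, its Taylor series at `0` may be evaluated at `1`.
  have hiter : ∀ n : ℕ, iteratedDeriv n G
      = fun s => ((varHermite c n).map (algebraMap ℝ ℂ)).eval ((x : ℂ) - s * c) * G s := by
    intro n
    induction n with
    | zero => ext s; simp [varHermite]
    | succ n ih =>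
      rw [iteratedDeriv_succ, ih]
      ext s
      have h1 : HasDerivAt (fun s : ℂ => (x : ℂ) - s * c) (-c) s := by
        simpa using ((hasDerivAt_id s).mul_const (c : ℂ)).const_sub (x : ℂ)
      have h2 := (Polynomial.hasDerivAt ((varHermite c n).map (algebraMap ℝ ℂ))
        ((x : ℂ) - s * c)).comp s h1
      have h3 := h2.mul (hd s).cexp
      refine (h3.deriv).trans ?_
      simp only [varHermite, Polynomial.map_sub, Polynomial.map_mul, Polynomial.map_X,
        Polynomial.map_C, Polynomial.eval_sub, Polynomial.eval_mul, Polynomial.eval_X,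
        Polynomial.eval_C, Polynomial.derivative_map, Function.comp_apply, hG,
        Complex.coe_algebraMap]
      ring
  have h := Complex.hasSum_taylorSeries_of_entire hGd 0 1
  simp_rw [hiter] at h
  rw [← Complex.hasSum_ofReal]
  convert! h using 1
  · ext n
    simp [hG, Polynomial.eval_map_algebraMap]
    left
    exact (Polynomial.ofReal_eval _ _)
  · simp [hG]
    ring_nf

/-- On functions of `[θ]` the operator `D_θ` acts as `c` times the derivative, since `c` is constant
on lines; `D_θ^*` is then the recurrence of `varHermite`. The parameter `c` may vary with `w`, which
covers the paths without convergence. -/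
lemma expSeries_dirDerivAdj_one {θ : WienerSpace} {c : WienerSpace → ℝ}
    (hb : ∀ (w : WienerSpace) (ε : ℝ), bracket θ (w + ε • θ) = bracket θ w + ε * c w)
    (hc : ∀ (w : WienerSpace) (ε : ℝ), c (w + ε • θ) = c w) :
    ExpSeriesWellDefined θ (dirDerivAdj θ) (fun _ => 1) ∧
      expSeries (dirDerivAdj θ) (fun _ => 1)
        = fun w => Real.exp (bracket θ w - 1 / 2 * c w) := by
  have hline : ∀ (n : ℕ) (w : WienerSpace) (ε : ℝ),
      (varHermite (c (w + ε • θ)) n).eval (bracket θ (w + ε • θ))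
        = ((varHermite (c w) n).comp
          (Polynomial.C (bracket θ w) + Polynomial.C (c w) * Polynomial.X)).eval ε := by
    intro n w ε
    rw [hb, hc]
    simp only [Polynomial.eval_comp, Polynomial.eval_mul, Polynomial.eval_add,
      Polynomial.eval_C, Polynomial.eval_X, mul_comm ε]
  have hD : ∀ n, (dirDerivAdj θ)^[n] (fun _ => 1)
      = fun w => (varHermite (c w) n).eval (bracket θ w) := by
    intro n
    induction n with
    | zero => ext w; simp [varHermite]
    | succ n ih =>
      rw [Function.iterate_succ_apply', ih]
      ext w
      rw [dirDerivAdj, (lineDifferentiableAt_and_dirDeriv_of_polynomial (hline n w)).2]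
      have hX : (Polynomial.C (bracket θ w) + Polynomial.C (c w) * Polynomial.X).derivative
          = Polynomial.C (c w) := by simp
      rw [Polynomial.derivative_comp, hX]
      simp only [varHermite, Polynomial.eval_comp, Polynomial.eval_mul, Polynomial.eval_add,
        Polynomial.eval_sub, Polynomial.eval_C, Polynomial.eval_X, mul_zero, add_zero]
      ring
  have hs : ∀ w, HasSum (fun n : ℕ => (1 / (n ! : ℝ)) * ((dirDerivAdj θ)^[n] (fun _ => 1)) w)
      (Real.exp (bracket θ w - 1 / 2 * c w)) := by
    intro w
    convert! hasSum_varHermite (c w) (bracket θ w) using 3 with n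
    exact congrFun (hD n) w
  refine ⟨⟨fun n w => ?_, fun w => (hs w).summable⟩, funext fun w => (hs w).tsum_eq⟩
  rw [hD]
  exact (lineDifferentiableAt_and_dirDeriv_of_polynomial (hline n w)).1

/-! ### The translation formula for polynomial functionals -/

lemma eval_bracket_add_smul {θ : WienerSpace}
    (hθ : θ ∈ cameronMartinSpace) {n : ℕ} {h : Fin n → WienerSpace}
    (hh : ∀ i, h i ∈ cameronMartinSpace) (p : MvPolynomial (Fin n) ℝ) (w : WienerSpace) (ε : ℝ) :
    MvPolynomial.eval (fun i => bracket (h i) (w + ε • θ)) p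
      = (MvPolynomial.aeval (fun i => Polynomial.C (bracket (h i) w)
          + Polynomial.C (pathShift (h i).velocity θ w) * Polynomial.X) p).eval ε := by
  have hb : ∀ i, bracket (h i) (w + ε • θ)
      = bracket (h i) w + ε * pathShift (h i).velocity θ w := fun i =>
    wienerIntegral_add_smul hθ (hh i).2 w ε
  induction p using MvPolynomial.induction_on with
  | C a => simp
  | add q r hq hr => simp only [map_add, Polynomial.eval_add, hq, hr]
  | mul_X q i hq =>
    rw [map_mul, map_mul, Polynomial.eval_mul, hq, MvPolynomial.eval_X, hb, mul_comm ε]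
    simp

theorem corollary2 (γ : Measure WienerSpace) (hγ : IsWienerMeasure γ)
    (θ : WienerSpace) (hθ : θ ∈ cameronMartinSpace)
    (F : WienerSpace → ℝ) (hF : F ∈ polynomialFunctionals) :
    -- the two exponential series are meaningful
    ExpSeriesWellDefined θ (dirDeriv θ) F ∧
    ExpSeriesWellDefined θ (dirDerivAdj θ) (fun _ => 1) ∧
    -- the four integrals are meaningful
    Integrable (fun w => F (w + θ)) γ ∧
    Integrable (expSeries (dirDeriv θ) F) γ ∧
    Integrable (fun w => F w * expSeries (dirDerivAdj θ) (fun _ => 1) w) γ ∧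
    Integrable (fun w => F w * cameronMartinDensity θ w) γ ∧
    -- and they are equal
    ∫ w, F (w + θ) ∂γ = ∫ w, expSeries (dirDeriv θ) F w ∂γ ∧
    ∫ w, expSeries (dirDeriv θ) F w ∂γ
      = ∫ w, F w * expSeries (dirDerivAdj θ) (fun _ => 1) w ∂γ ∧
    ∫ w, F w * expSeries (dirDerivAdj θ) (fun _ => 1) w ∂γ
      = ∫ w, F w * cameronMartinDensity θ w ∂γ := by
  have := hγ.isProbabilityMeasure
  obtain ⟨n, h, p, hh, hF⟩ := hF
  obtain rfl : F = fun w => MvPolynomial.eval (fun i => bracket (h i) w) p := funext hF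
  have hv : ∀ i, UnitL2 (h i).velocity := fun i => (hh i).2
  have hθv : UnitL2 θ.velocity := hθ.2
  obtain ⟨hD, hDe⟩ := expSeries_dirDeriv_of_polynomial (θ := θ)
    (F := fun w => MvPolynomial.eval (fun i => bracket (h i) w) p)
    (eval_bracket_add_smul hθ hh p)
  obtain ⟨hA, hAe⟩ := expSeries_dirDerivAdj_one (θ := θ) (c := pathShift θ.velocity θ)
    (wienerIntegral_add_smul hθ hθv) (pathShift_add_smul hθ hθv)
  set F : WienerSpace → ℝ := fun w => MvPolynomial.eval (fun i => bracket (h i) w) p with hFdef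
  have hdens : ∀ w, cameronMartinDensity θ w = Real.exp (wienerIntegral θ.velocity w)
      / Real.exp (1 / 2 * unitInner θ.velocity θ.velocity) := by
    intro w
    rw [← Real.exp_sub, cameronMartinDensity, unitInner]
    simp only [sq]
  -- Only almost everywhere: off the set of convergence the series uses slope `0`, whereas the
  -- density keeps the squared norm of `θ̇`.
  have hexp : (fun w => F w * expSeries (dirDerivAdj θ) (fun _ => 1) w)
      =ᵐ[γ] fun w => F w * cameronMartinDensity θ w := by
    filter_upwards [hγ.ae_dyadicConverges hθv] with w hw
    have hc : pathShift θ.velocity θ w = unitInner θ.velocity θ.velocity := if_pos hw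
    simp only [hAe, hdens, ← Real.exp_sub, hc, bracket]
  have hlaw := hγ.map_tilted_eq_map_add hθv hv
  have hm2 : AEMeasurable
      (fun w i => wienerIntegral (h i).velocity w + unitInner (h i).velocity θ.velocity) γ :=
    aemeasurable_pi_lambda _ fun i => (hγ.aemeasurable_wienerIntegral (hv i)).add_const _
  have hm1 : AEMeasurable (fun w i => wienerIntegral (h i).velocity w)
      (γ.tilted (wienerIntegral θ.velocity)) :=
    (aemeasurable_pi_lambda _ fun i => hγ.aemeasurable_wienerIntegral (hv i)).mono_ac
      (tilted_absolutelyContinuous _ _)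
  have hpm : Measurable fun x : Fin n → ℝ => MvPolynomial.eval x p :=
    (MvPolynomial.continuous_eval p).measurable
  have hshift : (fun w => F (w + θ)) =ᵐ[γ] fun w => MvPolynomial.eval
      (fun i => wienerIntegral (h i).velocity w + unitInner (h i).velocity θ.velocity) p := by
    filter_upwards [ae_all_iff.2 fun i => hγ.ae_dyadicConverges (hv i)] with w hw
    simp only [hFdef]
    congr 2
    ext i
    have := wienerIntegral_add_smul hθ (hv i) w 1
    rwa [one_smul, one_mul, pathShift, if_pos (hw i)] at this
  have hint : Integrable (fun w => F (w + θ)) γ := by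
    refine Integrable.congr ?_ hshift.symm
    exact memLp_one_iff_integrable.1 (memLp_eval_mvPolynomial (fun i q hq =>
      (hγ.memLp_wienerIntegral (hv i) hq).add (memLp_const _)) p 1 (by simp))
  -- Integrability is transported from `hint` through the equality of laws, so the product with the
  -- density needs no separate estimate.
  have hint2 : Integrable (fun w => F w * cameronMartinDensity θ w) γ := by
    have h1 : Integrable (fun x : Fin n → ℝ => MvPolynomial.eval x p)
        (γ.map fun w i => wienerIntegral (h i).velocity w
          + unitInner (h i).velocity θ.velocity) :=
      (integrable_map_measure hpm.aestronglyMeasurable hm2).2 (hint.congr hshift)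
    rw [← hlaw, integrable_map_measure hpm.aestronglyMeasurable hm1,
      integrable_tilted_iff (hγ.integrable_exp_wienerIntegral hθv)] at h1
    refine (h1.div_const (Real.exp (1 / 2 * unitInner θ.velocity θ.velocity))).congr
      (ae_of_all _ fun w => ?_)
    simp only [hdens, hFdef, bracket, smul_eq_mul, Function.comp_apply]
    ring
  -- Both sides are the integral of `p` against one and the same law on `ℝⁿ`.
  have heq : ∫ w, F (w + θ) ∂γ = ∫ w, F w * cameronMartinDensity θ w ∂γ := by
    rw [integral_congr_ae hshift,
      ← integral_map (f := fun x : Fin n → ℝ => MvPolynomial.eval x p) hm2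
        hpm.aestronglyMeasurable, ← hlaw, integral_map hm1 hpm.aestronglyMeasurable,
      integral_tilted, hγ.integral_exp_wienerIntegral hθv]
    refine integral_congr_ae (ae_of_all _ fun w => ?_)
    simp only [hdens, hFdef, bracket, smul_eq_mul]
    ring
  refine ⟨hD, hA, hint, ?_, hint2.congr hexp.symm, hint2, ?_, ?_, integral_congr_ae hexp⟩
  · rw [hDe]
    exact hint
  · rw [hDe]
  · rw [hDe, integral_congr_ae hexp]
    exact heq
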